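/- All Banach spaces are real. A map $f:X\to Y$ between Banach spaces is a coarse Lipschitz embedding if there exist $d\ge 0$ and $L,C>0$ such that for all $x,y\in X$ with $\|x-y\|\ge d$, $$\frac1C\|x-y\|\le\|f(x)-f(y)\|\le L\|x-y\|;$$ $X$ coarse Lipschitz embeds into $Y$ if such a map exists. For an infinite-dimensional Banach space $X$ put $$\tilde\delta_X(t)=\inf_{\substack{x\in X\\ \|x\|=1}}\ \sup_{\substack{Y\subseteq X\\ \dim(X/Y)<\infty}}\ \inf_{\substack{y\in Y\\ \|y\|=1}}\max\{\|x+ty\|,\|x-ty\|\}-1,$$ where $Y$ runs over the closed subspaces of $X$ of finite codimension, and call $X$ asymptotically midpoint uniformly convex (AMUC) if $\tilde\delta_X(t)>0$ for all $0<t\le1$. Let $\ell_p$ denote the space of $p$-summable real sequences with its $p$-norm and $c_0$ the space of real sequences that converge to $0$, with the supremum norm. Then: (i) For $1<p<q<\infty$, $\ell_q$ does not coarse Lipschitz embed into $\ell_p$. (ii) $c_0$ does not coarse Lipschitz embed into any infinite-dimensional AMUC Banach space. -/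

import Mathlib

open scoped ENNReal ZeroAtInfty

/-- `f` is a coarse Lipschitz embedding: it is bi-Lipschitz for large distances. -/
def IsCoarseLipschitzEmbedding {X Y : Type*} [NormedAddCommGroup X] [NormedAddCommGroup Y]
    (f : X → Y) : Prop :=
  ∃ d L C : ℝ, 0 ≤ d ∧ 0 < L ∧ 0 < C ∧ ∀ x y : X, d ≤ ‖x - y‖ →
    1 / C * ‖x - y‖ ≤ ‖f x - f y‖ ∧ ‖f x - f y‖ ≤ L * ‖x - y‖

/-- `X` coarse Lipschitz embeds into `Y`. -/
def CoarseLipschitzEmbeds (X Y : Type*) [NormedAddCommGroup X] [NormedAddCommGroup Y] : Prop :=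
  ∃ f : X → Y, IsCoarseLipschitzEmbedding f

/-- The closed subspaces of finite codimension of a normed space. -/
def FiniteCodimSubspace (X : Type*) [NormedAddCommGroup X] [NormedSpace ℝ X] : Type _ :=
  {Y : Submodule ℝ X // IsClosed (Y : Set X) ∧ FiniteDimensional ℝ (X ⧸ Y)}

/-- The asymptotic midpoint uniform convexity modulus of `X`. For infinite-dimensional `X` and
`0 ≤ t`, all index sets below are nonempty and all the values lie in `[1, 1 + t]`, so that the
real infima and suprema are the usual ones. -/
noncomputable def amucModulus (X : Type*) [NormedAddCommGroup X] [NormedSpace ℝ X] (t : ℝ) : ℝ :=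
  (⨅ x : {x : X // ‖x‖ = 1}, ⨆ Y : FiniteCodimSubspace X, ⨅ y : {y : X // y ∈ Y.1 ∧ ‖y‖ = 1},
    max ‖x.1 + t • y.1‖ ‖x.1 - t • y.1‖) - 1

/-- `X` is asymptotically midpoint uniformly convex. -/
def IsAMUC (X : Type*) [NormedAddCommGroup X] [NormedSpace ℝ X] : Prop :=
  ∀ t : ℝ, 0 < t → t ≤ 1 → 0 < amucModulus X t

/-!
The proof uses approximate midpoints. A coarse Lipschitz map `f` has a finite Lipschitz constant at
infinity, which is positive when `f` is an embedding. On pairs of points at large distance that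
almost attain it, `f` must map approximate midpoints to approximate midpoints, because neither half
of the way can be stretched by more than that constant (`exists_map_approx_midpoints`).

In the domain, the approximate midpoints of two points contain infinite separated sequences
(`HasMidpointSpread`): a vector of `c₀` or `ℓ_q` has small coordinates far out, and these can be
perturbed. In `c₀` this costs nothing, and in `ℓ_q` a perturbation of size `δ ^ (1 / q)` makes the
midpoints only `δ`-approximate, up to constants.

In the codomain, the approximate midpoints of `x` and `-x` in a suitable subspace `Y` of finite
codimension are small (`HasSmallMidpoints`). In `ℓ_p` their size is of order `δ ^ (1 / p)`, and in an
AMUC space it tends to `0` with `δ`. This controls all infinite sequences of midpoints: two terms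
almost agree modulo `Y`, and half their difference is a midpoint of `x` and `-x` that almost lies in
`Y` (`HasSmallMidpoints.exists_norm_sub_le`).

Hence the separation in the domain is at most a constant times the size in the codomain
(`HasMidpointSpread.le_of_coarseLipschitz`). For `c₀` and an AMUC space, the separation is a fixed
number and the size is arbitrarily small; for `ℓ_q` and `ℓ_p` with `p < q`, the separation
`δ ^ (1 / q)` exceeds any multiple of `δ ^ (1 / p)` as `δ` tends to `0`.
-/

/-! ### Approximate midpoints -/

/-- Around every unit vector `v` there is a `ρ`-separated sequence of perturbations `w n`, each of
which is a `δ`-approximate midpoint of `v` and `-v`. -/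
def HasMidpointSpread (X : Type*) [NormedAddCommGroup X] (δ ρ : ℝ) : Prop :=
  ∀ v : X, ‖v‖ = 1 → ∃ w : ℕ → X, (∀ n, ‖v + w n‖ ≤ 1 + δ ∧ ‖v - w n‖ ≤ 1 + δ) ∧
    ∀ n m, n ≠ m → ρ ≤ ‖w n - w m‖

/-- For every unit vector `x`, the `η`-approximate midpoints of `x` and `-x` that lie in a suitable
closed subspace of finite codimension have norm at most `τ`. -/
def HasSmallMidpoints (Z : Type*) [NormedAddCommGroup Z] [NormedSpace ℝ Z] (η τ : ℝ) : Prop :=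
  ∀ x : Z, ‖x‖ = 1 → ∃ Y : FiniteCodimSubspace Z, ∀ y ∈ Y.1,
    ‖x + y‖ ≤ 1 + η → ‖x - y‖ ≤ 1 + η → ‖y‖ ≤ τ

/-! ### Separated sequences of midpoints in the codomain -/

/-- Modulo a closed subspace of finite codimension, a bounded sequence has two terms that almost
coincide. -/
theorem exists_sub_eq_add_of_bounded {Z : Type*} [NormedAddCommGroup Z] [NormedSpace ℝ Z]
    (Y : FiniteCodimSubspace Z) {g : ℕ → Z} {M : ℝ} (hg : ∀ n, ‖g n‖ ≤ M) {ε : ℝ} (hε : 0 < ε) :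
    ∃ n m, n ≠ m ∧ ∃ y ∈ Y.1, ∃ e : Z, ‖e‖ < ε ∧ g n - g m = y + e := by
  obtain ⟨Y, hYc, hYf⟩ := Y
  have : IsClosed (Y : Set Z) := hYc
  have : ProperSpace (Z ⧸ Y) := FiniteDimensional.proper_real _
  obtain ⟨a, -, φ, hφ, hlim⟩ := tendsto_subseq_of_bounded
    (Metric.isBounded_closedBall (x := (0 : Z ⧸ Y)) (r := M))
    (x := fun n => (Submodule.Quotient.mk (g n) : Z ⧸ Y))
    (fun n => mem_closedBall_zero_iff.2 ((Submodule.Quotient.norm_mk_le Y (g n)).trans (hg n)))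
  obtain ⟨N, hN⟩ := Metric.cauchySeq_iff.1 hlim.cauchySeq (ε / 2) (half_pos hε)
  refine ⟨φ (N + 1), φ N, (hφ N.lt_succ_self).ne', ?_⟩
  have h := hN (N + 1) (by simp) N le_rfl
  rw [dist_eq_norm] at h
  simp only [Function.comp_apply, ← Submodule.Quotient.mk_sub] at h
  obtain ⟨e, he, hen⟩ := Submodule.Quotient.norm_mk_lt
    (Submodule.Quotient.mk (g (φ (N + 1)) - g (φ N)) : Z ⧸ Y) (half_pos hε)
  refine ⟨g (φ (N + 1)) - g (φ N) - e, ?_, e, by linarith, by abel⟩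
  exact (Submodule.Quotient.eq Y).1 he.symm

/-- If the approximate midpoints of `x` and `-x` are small modulo a subspace of finite codimension,
then an infinite sequence of slightly better approximate midpoints cannot be separated: half the
difference of two of them is again a midpoint, by convexity and symmetry. -/
theorem HasSmallMidpoints.exists_norm_sub_le {Z : Type*} [NormedAddCommGroup Z] [NormedSpace ℝ Z]
    {η η' τ : ℝ} (h : HasSmallMidpoints Z η τ) (hη : η' < η) (hτ : 0 < τ) {x : Z} (hx : ‖x‖ = 1)
    {g : ℕ → Z} (hg : ∀ n, ‖x + g n‖ ≤ 1 + η' ∧ ‖x - g n‖ ≤ 1 + η') :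
    ∃ n m, n ≠ m ∧ ‖g n - g m‖ ≤ 3 * τ := by
  obtain ⟨Y, hY⟩ := h x hx
  have hb : ∀ n, ‖g n‖ ≤ 1 + η' + 1 := fun n => by
    have : g n = (x + g n) - x := by abel
    rw [this]
    exact (norm_sub_le _ _).trans (by rw [hx]; linarith [(hg n).1])
  obtain ⟨n, m, hnm, y, hy, e, he, hd⟩ := exists_sub_eq_add_of_bounded Y hb
    (ε := min τ (2 * (η - η'))) (lt_min hτ (by linarith))
  have he1 := he.trans_le (min_le_left _ _)
  have he2 := he.trans_le (min_le_right _ _)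
  have half : ∀ a b c : Z, ‖(1 / 2 : ℝ) • (a + b - c)‖ ≤ (‖a‖ + ‖b‖ + ‖c‖) / 2 := fun a b c => by
    rw [norm_smul, Real.norm_of_nonneg (by norm_num)]
    have := (norm_sub_le (a + b) c).trans (add_le_add_left (norm_add_le a b) ‖c‖)
    linarith
  have hye : y = g n - g m - e := by rw [hd]; abel
  -- `y / 2` is within `‖e‖ / 2` of the average of the midpoints `g n` and `-g m`
  have key : ‖(1 / 2 : ℝ) • y‖ ≤ τ := by
    refine hY _ (Y.1.smul_mem _ hy) ?_ ?_
    · have : x + (1 / 2 : ℝ) • y = (1 / 2 : ℝ) • ((x + g n) + (x - g m) - e) := by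
        rw [hye]; module
      rw [this]
      exact (half _ _ _).trans (by linarith [(hg n).1, (hg m).2])
    · have : x - (1 / 2 : ℝ) • y = (1 / 2 : ℝ) • ((x - g n) + (x + g m) - -e) := by
        rw [hye]; module
      rw [this]
      exact (half _ _ _).trans (by rw [norm_neg]; linarith [(hg n).2, (hg m).1])
  rw [norm_smul, Real.norm_of_nonneg (by norm_num)] at key
  refine ⟨n, m, hnm, ?_⟩
  rw [hd]
  exact (norm_add_le _ _).trans (by linarith)

/-! ### The Lipschitz constant at infinity -/

/-- The approximate midpoint principle. Pairs `x`, `y` at large distance for which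
`‖f x - f y‖ / ‖x - y‖` almost attains the Lipschitz constant of `f` at infinity are such that
`f` maps approximate midpoints of `x` and `y` to approximate midpoints of `f x` and `f y`. -/
theorem exists_map_approx_midpoints {X Z : Type*} [NormedAddCommGroup X] [NormedSpace ℝ X]
    [Nontrivial X] [NormedAddCommGroup Z] {f : X → Z} {d L C : ℝ}
    (hC : 0 < C) (hf : ∀ x y : X, d ≤ ‖x - y‖ →
      1 / C * ‖x - y‖ ≤ ‖f x - f y‖ ∧ ‖f x - f y‖ ≤ L * ‖x - y‖)
    {δ η : ℝ} (hδ0 : 0 ≤ δ) (hδ1 : δ < 1) (hδη : δ < η) (t : ℝ) :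
    ∃ x y : X, t ≤ ‖x - y‖ ∧ ∀ z : X, ‖x - z‖ ≤ (1 + δ) / 2 * ‖x - y‖ →
      ‖y - z‖ ≤ (1 + δ) / 2 * ‖x - y‖ →
      ‖f x - f z‖ ≤ (1 + η) / 2 * ‖f x - f y‖ ∧ ‖f y - f z‖ ≤ (1 + η) / 2 * ‖f x - f y‖ := by
  set A : Set ℝ := {l | ∃ s : ℝ, ∀ x y : X, s ≤ ‖x - y‖ → ‖f x - f y‖ ≤ l * ‖x - y‖} with hA
  have hAL : L ∈ A := ⟨d, fun x y h => (hf x y h).2⟩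
  have hAC : ∀ l ∈ A, 1 / C ≤ l := by
    rintro l ⟨s, hs⟩
    obtain ⟨x, hx⟩ := NormedSpace.exists_lt_norm ℝ X (max (max d s) 0)
    have h0 : 0 < ‖x‖ := (le_max_right _ _).trans_lt hx
    have h1 := hs x 0 (by
      rw [sub_zero]; exact ((le_max_right _ _).trans (le_max_left _ _)).trans hx.le)
    have h2 := (hf x 0 (by
      rw [sub_zero]; exact ((le_max_left _ _).trans (le_max_left _ _)).trans hx.le)).1
    rw [sub_zero] at h1 h2
    exact le_of_mul_le_mul_right (h2.trans h1) h0
  set κ := sInf A with hκ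
  have hκ0 : 0 < κ := (one_div_pos.2 hC).trans_le (le_csInf ⟨L, hAL⟩ hAC)
  -- `f` expands by at most `θ κ` at large distances, and by at least `κ / θ` on some pairs; the two
  -- losses together amount to the factor `θ ^ 2`
  obtain ⟨θ, hθ1, hθ⟩ : ∃ θ : ℝ, 1 < θ ∧ θ * θ * (1 + δ) = 1 + η := by
    refine ⟨√((1 + η) / (1 + δ)), ?_, ?_⟩
    · rw [Real.lt_sqrt zero_le_one, one_pow, lt_div_iff₀ (by linarith)]; linarith
    · rw [Real.mul_self_sqrt (div_nonneg (by linarith) (by linarith))]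
      field_simp
  have hθ0 : 0 < θ := by linarith
  obtain ⟨l, ⟨s, hs⟩, hl⟩ := exists_lt_of_csInf_lt (⟨L, hAL⟩ : A.Nonempty)
    (show sInf A < θ * κ by rw [← hκ]; nlinarith)
  have hnot : κ / θ ∉ A := fun h =>
    (csInf_le ⟨1 / C, hAC⟩ h).not_gt (by rw [← hκ]; exact div_lt_self hκ0 hθ1)
  -- the distance is so large that all midpoints are at distance at least `s` from `x` and `y`
  have hnot' : ∃ x y : X, max (max t 0) (2 * s / (1 - δ)) ≤ ‖x - y‖ ∧
      κ / θ * ‖x - y‖ < ‖f x - f y‖ := by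
    by_contra! hcon
    exact hnot ⟨_, hcon⟩
  obtain ⟨x, y, hxy, hgt⟩ := hnot'
  have hsxy : s ≤ (1 - δ) / 2 * ‖x - y‖ := by
    have := (le_max_right _ _).trans hxy
    rw [div_le_iff₀ (by linarith)] at this
    linarith
  have step : ∀ a b z : X, ‖a - b‖ = ‖x - y‖ → ‖a - z‖ ≤ (1 + δ) / 2 * ‖x - y‖ →
      ‖b - z‖ ≤ (1 + δ) / 2 * ‖x - y‖ → ‖f a - f z‖ ≤ (1 + η) / 2 * ‖f x - f y‖ := by
    intro a b z hab haz hbz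
    have htri : ‖a - b‖ ≤ ‖a - z‖ + ‖b - z‖ := by
      rw [norm_sub_rev b z]; exact norm_sub_le_norm_sub_add_norm_sub a z b
    have h1 := hs a z (by linarith)
    calc ‖f a - f z‖ ≤ l * ‖a - z‖ := h1
      _ ≤ θ * κ * ((1 + δ) / 2 * ‖x - y‖) :=
        mul_le_mul hl.le haz (norm_nonneg _) (by positivity)
      _ = (θ * θ * (1 + δ)) / 2 * (κ / θ * ‖x - y‖) := by field_simp
      _ = (1 + η) / 2 * (κ / θ * ‖x - y‖) := by rw [hθ]
      _ ≤ _ := mul_le_mul_of_nonneg_left hgt.le (by linarith)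
  refine ⟨x, y, ((le_max_left _ _).trans (le_max_left _ _)).trans hxy, fun z hx hy => ⟨?_, ?_⟩⟩
  · exact step x y z rfl hx hy
  · exact step y x z (norm_sub_rev y x) hy hx

/-- A coarse Lipschitz embedding carries the separated approximate midpoints of its domain to
approximate midpoints in its codomain, of which two must be close; this bounds the separation. -/
theorem HasMidpointSpread.le_of_coarseLipschitz {X Z : Type*} [NormedAddCommGroup X]
    [NormedSpace ℝ X] [Nontrivial X] [NormedAddCommGroup Z] [NormedSpace ℝ Z] {f : X → Z}
    {d L C : ℝ} (hC : 0 < C) (hf : ∀ x y : X, d ≤ ‖x - y‖ →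
      1 / C * ‖x - y‖ ≤ ‖f x - f y‖ ∧ ‖f x - f y‖ ≤ L * ‖x - y‖)
    {δ ρ η τ : ℝ} (hX : HasMidpointSpread X δ ρ) (hZ : HasSmallMidpoints Z η τ)
    (hδ0 : 0 ≤ δ) (hδ1 : δ < 1) (hδη : δ < η) (hρ : 0 < ρ) (hτ : 0 < τ) :
    ρ ≤ 3 * C * L * τ := by
  obtain ⟨η', h1, h2⟩ := exists_between hδη
  obtain ⟨x, y, hxy, hmid⟩ := exists_map_approx_midpoints hC hf hδ0 hδ1 h1
    (max (max 1 d) (2 * d / ρ))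
  have hxy1 : 1 ≤ ‖x - y‖ := ((le_max_left _ _).trans (le_max_left _ _)).trans hxy
  have hxyd : d ≤ ‖x - y‖ := ((le_max_right _ _).trans (le_max_left _ _)).trans hxy
  have hxyρ : d ≤ ρ * (‖x - y‖ / 2) := by
    have := (le_max_right _ _).trans hxy
    rw [div_le_iff₀ hρ] at this
    linarith
  obtain ⟨hlow, hup⟩ := hf x y hxyd
  set D := ‖x - y‖ with hD
  set E := ‖f x - f y‖ with hE
  have hD0 : 0 < D := by linarith
  have hE0 : 0 < E := (mul_pos (one_div_pos.2 hC) hD0).trans_le hlow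
  obtain ⟨w, hw, hsep⟩ := hX (D⁻¹ • (x - y)) (by
    rw [norm_smul, norm_inv, hD, norm_norm, inv_mul_cancel₀ hD0.ne'])
  -- the separated midpoints of `x` and `y`, and their images recentred and rescaled so that they
  -- become midpoints of a unit vector and its negative
  set z : ℕ → X := fun n => (1 / 2 : ℝ) • (x + y) + (D / 2) • w n with hz
  have hxz : ∀ n, ‖x - z n‖ ≤ (1 + δ) / 2 * D := fun n => by
    have : x - z n = (D / 2) • (D⁻¹ • (x - y) - w n) := by
      rw [smul_sub, smul_smul, show D / 2 * D⁻¹ = 1 / 2 by field_simp]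
      simp only [hz]; module
    rw [this, norm_smul, Real.norm_of_nonneg (by positivity)]
    nlinarith [(hw n).2]
  have hyz : ∀ n, ‖y - z n‖ ≤ (1 + δ) / 2 * D := fun n => by
    have : y - z n = -((D / 2) • (D⁻¹ • (x - y) + w n)) := by
      rw [smul_add, smul_smul, show D / 2 * D⁻¹ = 1 / 2 by field_simp]
      simp only [hz]; module
    rw [this, norm_neg, norm_smul, Real.norm_of_nonneg (by positivity)]
    nlinarith [(hw n).1]
  set g : ℕ → Z := fun n => (2 / E) • (f (z n) - (1 / 2 : ℝ) • (f x + f y)) with hg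
  have hgm : ∀ n, ‖E⁻¹ • (f x - f y) + g n‖ ≤ 1 + η' ∧ ‖E⁻¹ • (f x - f y) - g n‖ ≤ 1 + η' := by
    intro n
    obtain ⟨ha, hb⟩ := hmid (z n) (hxz n) (hyz n)
    have hE2 : (2 / E) * ((1 + η') / 2 * E) = 1 + η' := by field_simp
    constructor
    · have : E⁻¹ • (f x - f y) + g n = -((2 / E) • (f y - f (z n))) := by
        simp only [hg]
        rw [show E⁻¹ = (2 / E) * (1 / 2) by field_simp]
        module
      rw [this, norm_neg, norm_smul, Real.norm_of_nonneg (by positivity), ← hE2]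
      exact mul_le_mul_of_nonneg_left hb (by positivity)
    · have : E⁻¹ • (f x - f y) - g n = (2 / E) • (f x - f (z n)) := by
        simp only [hg]
        rw [show E⁻¹ = (2 / E) * (1 / 2) by field_simp]
        module
      rw [this, norm_smul, Real.norm_of_nonneg (by positivity), ← hE2]
      exact mul_le_mul_of_nonneg_left ha (by positivity)
  obtain ⟨n, m, hnm, hclose⟩ := hZ.exists_norm_sub_le h2 hτ (x := E⁻¹ • (f x - f y)) (by
    rw [norm_smul, norm_inv, hE, norm_norm, inv_mul_cancel₀ hE0.ne']) hgm
  have hgd : ‖f (z n) - f (z m)‖ ≤ 3 * τ * (E / 2) := by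
    have : f (z n) - f (z m) = (E / 2) • (g n - g m) := by
      simp only [hg]
      rw [← smul_sub, smul_smul, show E / 2 * (2 / E) = 1 by field_simp, one_smul]
      abel
    rw [this, norm_smul, Real.norm_of_nonneg (by positivity)]
    nlinarith
  have hzd : ρ * (D / 2) ≤ ‖z n - z m‖ := by
    have : z n - z m = (D / 2) • (w n - w m) := by simp only [hz]; module
    rw [this, norm_smul, Real.norm_of_nonneg (by positivity), mul_comm]
    exact mul_le_mul_of_nonneg_left (hsep n m hnm) (by positivity)
  have h3 := (hf (z n) (z m) (hxyρ.trans hzd)).1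
  have h4 : ρ * (D / 2) / C ≤ 3 * τ * (L * D / 2) := by
    calc ρ * (D / 2) / C = 1 / C * (ρ * (D / 2)) := by ring
      _ ≤ 1 / C * ‖z n - z m‖ := mul_le_mul_of_nonneg_left hzd (by positivity)
      _ ≤ 3 * τ * (E / 2) := h3.trans hgd
      _ ≤ _ := by gcongr
  rw [div_le_iff₀ hC] at h4
  refine le_of_mul_le_mul_right (a := D / 2) ?_ (by positivity)
  linarith

/-! ### Asymptotically midpoint uniformly convex spaces -/

/-- In an AMUC space the approximate midpoints are small modulo finite codimension. -/
theorem IsAMUC.hasSmallMidpoints {X : Type*} [NormedAddCommGroup X] [NormedSpace ℝ X]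
    (h : IsAMUC X) {τ : ℝ} (hτ : 0 < τ) (hτ1 : τ ≤ 1) :
    HasSmallMidpoints X (amucModulus X τ / 2) τ := by
  have hpos := h τ hτ hτ1
  intro x hx
  have hin : ∀ (x : X) (Y : FiniteCodimSubspace X),
      0 ≤ ⨅ y : {y : X // y ∈ Y.1 ∧ ‖y‖ = 1}, max ‖x + τ • y.1‖ ‖x - τ • y.1‖ := fun x Y =>
    Real.iInf_nonneg fun y => le_max_of_le_left (norm_nonneg _)
  have h1 : 1 + amucModulus X τ ≤ ⨆ Y : FiniteCodimSubspace X,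
      ⨅ y : {y : X // y ∈ Y.1 ∧ ‖y‖ = 1}, max ‖x + τ • y.1‖ ‖x - τ • y.1‖ := by
    have := ciInf_le (f := fun x : {x : X // ‖x‖ = 1} => ⨆ Y : FiniteCodimSubspace X,
      ⨅ y : {y : X // y ∈ Y.1 ∧ ‖y‖ = 1}, max ‖x.1 + τ • y.1‖ ‖x.1 - τ • y.1‖)
      ⟨0, by rintro _ ⟨x, rfl⟩; exact Real.iSup_nonneg (hin x.1)⟩ ⟨x, hx⟩
    rw [amucModulus]
    linarith
  have : Nonempty (FiniteCodimSubspace X) := ⟨⟨⊤, isClosed_univ, inferInstance⟩⟩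
  obtain ⟨Y, hY⟩ := exists_lt_of_lt_ciSup
    (show 1 + amucModulus X τ / 2 < _ from lt_of_lt_of_le (by linarith) h1)
  refine ⟨Y, fun y hy ha hb => ?_⟩
  by_contra! hlt
  have hy0 : 0 < ‖y‖ := hτ.trans hlt
  have h2 := hY.trans_le (ciInf_le ⟨0, by
    rintro _ ⟨y, rfl⟩; exact le_max_of_le_left (norm_nonneg _)⟩
    (⟨‖y‖⁻¹ • y, Y.1.smul_mem _ hy, by
      rw [norm_smul, norm_inv, norm_norm, inv_mul_cancel₀ hy0.ne']⟩ :
      {y : X // y ∈ Y.1 ∧ ‖y‖ = 1}))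
  -- `x ± τ ‖y‖⁻¹ y` are convex combinations of `x + y` and `x - y`
  have hc : τ * ‖y‖⁻¹ ≤ 1 := by rw [← div_eq_mul_inv]; exact (div_le_one hy0).2 hlt.le
  have hc0 : 0 ≤ τ * ‖y‖⁻¹ := by positivity
  simp only [smul_smul] at h2
  generalize τ * ‖y‖⁻¹ = c at h2 hc hc0
  have comb : ∀ a b : X, ‖a‖ ≤ 1 + amucModulus X τ / 2 → ‖b‖ ≤ 1 + amucModulus X τ / 2 →
      ‖((1 + c) / 2) • a + ((1 - c) / 2) • b‖ ≤ 1 + amucModulus X τ / 2 := by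
    intro a b ha hb
    refine (norm_add_le _ _).trans ?_
    rw [norm_smul, norm_smul, Real.norm_of_nonneg (by linarith), Real.norm_of_nonneg (by linarith)]
    nlinarith
  refine h2.not_ge (max_le ?_ ?_)
  · have : x + c • y = ((1 + c) / 2) • (x + y) + ((1 - c) / 2) • (x - y) := by module
    rw [this]; exact comb _ _ ha hb
  · have : x - c • y = ((1 + c) / 2) • (x - y) + ((1 - c) / 2) • (x + y) := by module
    rw [this]; exact comb _ _ hb ha

/-! ### Midpoints in `c₀` -/

/-- The unit vector `e k` of `c₀`. -/
noncomputable def c0Single (k : ℕ) : C₀(ℕ, ℝ) where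
  toFun := Pi.single k 1
  continuous_toFun := continuous_of_discreteTopology
  zero_at_infty' := by
    rw [Filter.cocompact_eq_cofinite]
    refine tendsto_const_nhds.congr' ?_
    filter_upwards [(Set.finite_singleton k).compl_mem_cofinite] with n hn
    exact (Pi.single_eq_of_ne (M := fun _ => ℝ) hn 1).symm

theorem c0Single_self (k : ℕ) : c0Single k k = 1 := Pi.single_eq_same (M := fun _ => ℝ) k 1

theorem c0Single_of_ne {k n : ℕ} (h : n ≠ k) : c0Single k n = 0 :=
  Pi.single_eq_of_ne (M := fun _ => ℝ) h 1

theorem abs_apply_le_norm_c0 (v : C₀(ℕ, ℝ)) (n : ℕ) : |v n| ≤ ‖v‖ :=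
  BoundedContinuousFunction.norm_coe_le_norm v.toBCF n

theorem norm_c0_le {v : C₀(ℕ, ℝ)} {M : ℝ} (hM : 0 ≤ M) (h : ∀ n, |v n| ≤ M) : ‖v‖ ≤ M :=
  (BoundedContinuousFunction.norm_le (f := v.toBCF) hM).2 h

instance nontrivial_c0 : Nontrivial C₀(ℕ, ℝ) :=
  ⟨⟨c0Single 0, 0, fun h => by simpa [c0Single_self] using DFunLike.congr_fun h 0⟩⟩

/-- Adding `±1/2` to a coordinate in which a unit vector of `c₀` is small does not increase its
norm. -/
theorem hasMidpointSpread_c0 : HasMidpointSpread C₀(ℕ, ℝ) 0 (1 / 2) := by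
  intro v hv
  have hlim : Filter.Tendsto v Filter.atTop (nhds 0) := by
    rw [← Nat.cofinite_eq_atTop, ← Filter.cocompact_eq_cofinite]
    exact v.zero_at_infty'
  obtain ⟨N, hN⟩ := Metric.tendsto_atTop.1 hlim (1 / 2) (by norm_num)
  have hv1 : ∀ i, |v i| ≤ 1 := fun i => hv ▸ abs_apply_le_norm_c0 v i
  refine ⟨fun n => (1 / 2 : ℝ) • c0Single (N + n), fun n => ?_, fun n m hnm => ?_⟩
  · have hk := hN (N + n) (by omega)
    rw [Real.dist_eq, sub_zero, abs_lt] at hk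
    constructor <;> refine norm_c0_le (by norm_num) fun i => ?_ <;>
      rcases eq_or_ne i (N + n) with rfl | hi
    · simp only [ZeroAtInftyContinuousMap.add_apply, ZeroAtInftyContinuousMap.smul_apply,
        c0Single_self, smul_eq_mul]
      rw [abs_le]; constructor <;> linarith
    · simpa [c0Single_of_ne hi] using hv1 i
    · simp only [ZeroAtInftyContinuousMap.sub_apply, ZeroAtInftyContinuousMap.smul_apply,
        c0Single_self, smul_eq_mul]
      rw [abs_le]; constructor <;> linarith
    · simpa [c0Single_of_ne hi] using hv1 i
  · have h := abs_apply_le_norm_c0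
      ((1 / 2 : ℝ) • c0Single (N + n) - (1 / 2 : ℝ) • c0Single (N + m)) (N + n)
    refine le_trans ?_ h
    simp only [ZeroAtInftyContinuousMap.sub_apply, ZeroAtInftyContinuousMap.smul_apply,
      c0Single_self, c0Single_of_ne (show N + n ≠ N + m by omega), smul_eq_mul]
    norm_num

/-! ### Midpoints in `ℓ_p` -/

theorem lp_norm_add_rpow_of_disjoint {p : ℝ≥0∞} (hp : 0 < p.toReal) (f g : lp (fun _ : ℕ => ℝ) p)
    (h : ∀ i, f i = 0 ∨ g i = 0) :
    ‖f + g‖ ^ p.toReal = ‖f‖ ^ p.toReal + ‖g‖ ^ p.toReal := by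
  refine (lp.hasSum_norm hp (f + g)).unique ?_
  convert (lp.hasSum_norm hp f).add (lp.hasSum_norm hp g) using 2 with i
  rcases h i with h | h <;> simp [h, Real.zero_rpow hp.ne']

theorem nontrivial_lp (p : ℝ≥0∞) : Nontrivial (lp (fun _ : ℕ => ℝ) p) :=
  ⟨⟨lp.single p 0 1, 0, fun h => by
    have := congrArg (fun f : lp (fun _ : ℕ => ℝ) p => f 0) h
    simp at this⟩⟩

/-- Adding `±s` to a coordinate in which a unit vector of `ℓ_q` is at most `s` increases its norm
to at most `(1 + (2 s) ^ q) ^ (1 / q) ≤ 1 + (2 s) ^ q`. -/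
theorem hasMidpointSpread_lp {q : ℝ≥0∞} [Fact (1 ≤ q)] (hq : q ≠ ∞) {s : ℝ} (hs : 0 < s) :
    HasMidpointSpread (lp (fun _ : ℕ => ℝ) q) ((2 * s) ^ q.toReal) s := by
  have hq1 : 1 ≤ q.toReal := (ENNReal.dichotomy q).resolve_left hq
  have hq0 : 0 < q.toReal := by linarith
  have hqne : q ≠ 0 := (zero_lt_one.trans_le (Fact.out : 1 ≤ q)).ne'
  intro v hv
  have hlim : Filter.Tendsto (fun i => ‖v i‖ ^ q.toReal) Filter.atTop (nhds 0) :=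
    (lp.hasSum_norm hq0 v).summable.tendsto_atTop_zero
  obtain ⟨N, hN⟩ := Filter.eventually_atTop.1
    (hlim.eventually (gt_mem_nhds (Real.rpow_pos_of_pos hs q.toReal)))
  have bound : ∀ k, N ≤ k → ∀ c : ℝ, |c| ≤ s →
      ‖v + lp.single q k c‖ ≤ 1 + (2 * s) ^ q.toReal := by
    intro k hk c hc
    have hvk : |v k| < s := (Real.rpow_lt_rpow_iff (abs_nonneg _) hs.le hq0).1 (hN k hk)
    have hdec : v + lp.single q k c = (v - lp.single q k (v k)) + lp.single q k (v k + c) := by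
      rw [lp.single_add]; abel
    have h1 := lp_norm_add_rpow_of_disjoint hq0 (v - lp.single q k (v k))
      (lp.single q k (v k + c)) (fun i => by
        rcases eq_or_ne i k with rfl | hi
        · left; simp
        · right; simp [hi])
    have h2 : ‖v - lp.single q k (v k)‖ ^ q.toReal ≤ 1 := by
      have := lp.norm_compl_sum_single hq0 v {k}
      rw [Finset.sum_singleton, Finset.sum_singleton, hv, Real.one_rpow] at this
      have h0 : 0 ≤ ‖v k‖ ^ q.toReal := by positivity
      linarith
    have h3 : ‖lp.single (E := fun _ : ℕ => ℝ) q k (v k + c)‖ ^ q.toReal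
        ≤ (2 * s) ^ q.toReal := by
      rw [lp.norm_single (E := fun _ : ℕ => ℝ) hqne.bot_lt]
      refine Real.rpow_le_rpow (norm_nonneg _) ?_ hq0.le
      exact (norm_add_le _ _).trans (by rw [Real.norm_eq_abs, Real.norm_eq_abs]; linarith)
    have h4 : (0 : ℝ) ≤ (2 * s) ^ q.toReal := by positivity
    rw [← Real.rpow_le_rpow_iff (norm_nonneg _) (by linarith) hq0, hdec, h1]
    calc _ ≤ 1 + (2 * s) ^ q.toReal := add_le_add h2 h3
      _ ≤ _ := Real.self_le_rpow_of_one_le (by linarith) hq1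
  refine ⟨fun n => lp.single q (N + n) s, fun n => ⟨?_, ?_⟩, fun n m hnm => ?_⟩
  · exact bound _ (by omega) s (abs_of_pos hs).le
  · rw [sub_eq_add_neg, ← lp.single_neg]
    exact bound _ (by omega) (-s) (by rw [abs_neg, abs_of_pos hs])
  · refine le_trans ?_ (lp.norm_apply_le_norm hqne _ (N + n))
    have : N + n ≠ N + m := by omega
    rw [lp.coeFn_sub, Pi.sub_apply, lp.single_apply_self, lp.single_apply_ne _ _ _ this, sub_zero]
    exact le_abs_self s

/-- The vectors of `ℓ_p` that vanish on a given finite set of coordinates. -/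
noncomputable def lpVanishing (p : ℝ≥0∞) [Fact (1 ≤ p)] (s : Finset ℕ) :
    FiniteCodimSubspace (lp (fun _ : ℕ => ℝ) p) :=
  let T : lp (fun _ : ℕ => ℝ) p →L[ℝ] (s → ℝ) :=
    ContinuousLinearMap.pi fun i => lp.evalCLM ℝ (fun _ : ℕ => ℝ) p i.1
  ⟨LinearMap.ker T.toLinearMap, T.isClosed_ker,
    T.toLinearMap.quotKerEquivRange.symm.finiteDimensional⟩

theorem apply_eq_zero_of_mem_lpVanishing {p : ℝ≥0∞} [Fact (1 ≤ p)] {s : Finset ℕ}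
    {y : lp (fun _ : ℕ => ℝ) p} (hy : y ∈ (lpVanishing p s).1) {i : ℕ} (hi : i ∈ s) :
    y i = 0 :=
  congrFun (LinearMap.mem_ker.1 hy) ⟨i, hi⟩

theorem rpow_add_two_mul_sub_rpow_sub_le {r η : ℝ} (hr : 1 ≤ r) (hη : 0 ≤ η) (hη1 : η ≤ 1 / 2) :
    (1 + 2 * η) ^ r - (1 - η) ^ r ≤ (2 * 2 ^ r + r) * η := by
  have h1 : 1 - r * η ≤ (1 - η) ^ r := by
    have := one_add_mul_self_le_rpow_one_add (s := -η) (by linarith) hr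
    rw [← sub_eq_add_neg] at this
    linarith
  have h2 := (convexOn_rpow hr).2 (Set.mem_Ici.2 zero_le_one) (Set.mem_Ici.2 zero_le_two)
    (show 0 ≤ 1 - 2 * η by linarith) (show 0 ≤ 2 * η by linarith) (by ring)
  simp only [smul_eq_mul, Real.one_rpow, mul_one] at h2
  rw [show 1 - 2 * η + 2 * η * 2 = 1 + 2 * η by ring] at h2
  nlinarith

/-- Approximate midpoints in `ℓ_p`: a unit vector is almost supported on finitely many coordinates,
and a vector `y` vanishing there adds `‖y‖ ^ p` to the `p`-th power of its norm. -/
theorem hasSmallMidpoints_lp {p : ℝ≥0∞} [Fact (1 ≤ p)] (hp : p ≠ ∞) {η : ℝ} (hη : 0 < η)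
    (hη1 : η ≤ 1 / 2) :
    HasSmallMidpoints (lp (fun _ : ℕ => ℝ) p) η
      (((2 * 2 ^ p.toReal + p.toReal) * η) ^ (1 / p.toReal)) := by
  have hp1 : 1 ≤ p.toReal := (ENNReal.dichotomy p).resolve_left hp
  have hp0 : 0 < p.toReal := by linarith
  intro x hx
  obtain ⟨s, hs⟩ := (Metric.tendsto_nhds.1 (lp.hasSum_single hp x) η hη).exists
  rw [dist_eq_norm] at hs
  set a := ∑ i ∈ s, lp.single p i (x i) with ha
  have ha_apply : ∀ i, i ∉ s → a i = 0 := fun i hi => by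
    rw [ha, lp.coeFn_sum, Finset.sum_apply]
    exact Finset.sum_eq_zero fun j hj => lp.single_apply_ne p j _ (ne_of_mem_of_not_mem hj hi).symm
  refine ⟨lpVanishing p s, fun y hy h1 _ => ?_⟩
  have h2 := lp_norm_add_rpow_of_disjoint hp0 a y (fun i => by
    by_cases hi : i ∈ s
    · exact Or.inr (apply_eq_zero_of_mem_lpVanishing hy hi)
    · exact Or.inl (ha_apply i hi))
  have h3 : ‖a + y‖ ≤ 1 + 2 * η := by
    rw [show a + y = (x + y) + (a - x) by abel]
    exact (norm_add_le _ _).trans (by linarith)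
  have h4 : 1 - η ≤ ‖a‖ := by
    have := norm_sub_norm_le x a
    rw [norm_sub_rev, hx] at this
    linarith
  have h5 := Real.rpow_le_rpow (norm_nonneg _) h3 hp0.le
  have h6 := Real.rpow_le_rpow (by linarith) h4 hp0.le
  have h7 := rpow_add_two_mul_sub_rpow_sub_le hp1 hη.le hη1
  rw [one_div, Real.le_rpow_inv_iff_of_pos (norm_nonneg _) (by positivity) hp0]
  linarith

/-! ### Nonexistence of coarse Lipschitz embeddings -/

/-- With `δ = (2 s) ^ Q`, the separation `s` of `δ`-approximate midpoints in `ℓ_Q` exceeds the size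
`(K (2 δ)) ^ (1 / P)` of `2 δ`-approximate midpoints in `ℓ_P` by any given factor `M`, once `s` is
small. -/
theorem exists_mul_rpow_lt {P Q : ℝ} (hP : 0 < P) (hPQ : P < Q) (M K : ℝ) (hK : 0 ≤ K) :
    ∃ s : ℝ, 0 < s ∧ (2 * s) ^ Q ≤ 1 / 4 ∧ M * (K * (2 * (2 * s) ^ Q)) ^ (1 / P) < s := by
  have ht : Filter.Tendsto (fun s : ℝ => s) (nhdsWithin 0 (Set.Ioi 0)) (nhds 0) :=
    tendsto_nhdsWithin_of_tendsto_nhds Filter.tendsto_id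
  have hQ : 0 < Q := hP.trans hPQ
  have hexp : 0 < Q / P - 1 := by rw [sub_pos, one_lt_div hP]; exact hPQ
  have t1 : Filter.Tendsto (fun s : ℝ => (2 * s) ^ Q) (nhdsWithin 0 (Set.Ioi 0)) (nhds 0) := by
    simpa [Real.zero_rpow hQ.ne'] using (ht.const_mul 2).rpow_const (p := Q) (Or.inr hQ.le)
  have t2 : Filter.Tendsto (fun s : ℝ => M * (K * (2 * 2 ^ Q)) ^ (1 / P) * s ^ (Q / P - 1))
      (nhdsWithin 0 (Set.Ioi 0)) (nhds 0) := by
    simpa [Real.zero_rpow hexp.ne'] using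
      (ht.rpow_const (p := Q / P - 1) (Or.inr hexp.le)).const_mul (M * (K * (2 * 2 ^ Q)) ^ (1 / P))
  obtain ⟨s, ⟨h1, h2⟩, hs⟩ := ((t1.eventually (ge_mem_nhds (by norm_num : (0 : ℝ) < 1 / 4))).and
    (t2.eventually (gt_mem_nhds zero_lt_one))).and self_mem_nhdsWithin |>.exists
  have hs : 0 < s := hs
  refine ⟨s, hs, h1, ?_⟩
  have h3 : (K * (2 * (2 * s) ^ Q)) ^ (1 / P) =
      (K * (2 * 2 ^ Q)) ^ (1 / P) * s ^ (Q / P - 1) * s := by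
    rw [Real.mul_rpow zero_le_two hs.le,
      show K * (2 * (2 ^ Q * s ^ Q)) = K * (2 * 2 ^ Q) * s ^ Q by ring,
      Real.mul_rpow (by positivity) (by positivity), ← Real.rpow_mul hs.le, mul_assoc,
      ← Real.rpow_add_one hs.ne']
    congr 2
    ring
  rw [h3]
  nlinarith

theorem mainTheorem5 :
    (∀ (p q : ℝ≥0∞) [Fact (1 ≤ p)] [Fact (1 ≤ q)], 1 < p → p < q → q < ∞ →
      ¬ CoarseLipschitzEmbeds (lp (fun _ : ℕ => ℝ) q) (lp (fun _ : ℕ => ℝ) p)) ∧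
    (∀ (X : Type*) [NormedAddCommGroup X] [NormedSpace ℝ X] [CompleteSpace X],
      ¬ FiniteDimensional ℝ X → IsAMUC X → ¬ CoarseLipschitzEmbeds C₀(ℕ, ℝ) X) := by
  constructor
  · rintro p q _ _ hp hpq hq ⟨f, d, L, C, -, hL, hC, hf⟩
    have hp' : p ≠ ∞ := (hpq.trans hq).ne
    have hP : 0 < p.toReal := ENNReal.toReal_pos (zero_lt_one.trans hp).ne' hp'
    have hPQ : p.toReal < q.toReal := (ENNReal.toReal_lt_toReal hp' hq.ne).2 hpq
    have := nontrivial_lp q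
    obtain ⟨s, hs, hs1, hs2⟩ := exists_mul_rpow_lt hP hPQ (3 * C * L)
      (2 * 2 ^ p.toReal + p.toReal) (by positivity)
    have hδ : 0 < (2 * s) ^ q.toReal := by positivity
    exact hs2.not_ge ((hasMidpointSpread_lp hq.ne hs).le_of_coarseLipschitz hC hf
      (hasSmallMidpoints_lp hp' (η := 2 * (2 * s) ^ q.toReal) (by positivity) (by linarith))
      hδ.le (by linarith) (by linarith) hs (by positivity))
  · rintro X _ _ _ - hX ⟨f, d, L, C, -, hL, hC, hf⟩
    set τ : ℝ := min 1 (1 / (12 * C * L)) with hτ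
    have hτ0 : 0 < τ := by positivity
    have h := hasMidpointSpread_c0.le_of_coarseLipschitz hC hf
      (hX.hasSmallMidpoints hτ0 (min_le_left _ _)) le_rfl zero_lt_one
      (half_pos (hX τ hτ0 (min_le_left _ _))) (by norm_num) hτ0
    have h2 : 3 * C * L * τ ≤ 3 * C * L * (1 / (12 * C * L)) :=
      mul_le_mul_of_nonneg_left (min_le_right _ _) (by positivity)
    have h3 : 3 * C * L * (1 / (12 * C * L)) = 1 / 4 := by field_simp; norm_num
    linarith
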